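/- Let $X=\theta+\varepsilon\in\mathbb R^n$ with $\varepsilon_1,\dots,\varepsilon_n$ i.i.d. $\mathcal N(0,1)$, let $P_\theta$ be the law of $X$ and $S_\theta=\{i:\theta_i\neq0\}$. A multiple testing procedure is a measurable map $\varphi:\mathbb R^n\to\{0,1\}^n$ ($\varphi_i=1$ rejects $\theta_i=0$), and sequences of procedures indexed by $n$ are also called procedures. Put \[ \mathrm{FDR}(\theta,\varphi)=E_\theta\Big[\frac{\sum_i \mathbf 1\{\theta_i=0\}\varphi_i(X)}{1\vee\sum_i\varphi_i(X)}\Big],\qquad \mathrm{FNR}(\theta,\varphi)=E_\theta\Big[\frac{\sum_i \mathbf 1\{\theta_i\ne0\}(1-\varphi_i(X))}{1\vee|S_\theta|}\Big], \] and $\mathfrak R=\mathrm{FDR}+\mathrm{FNR}$. Let $(s_n)$ be positive integers with $s_n\to\infty$ and $n/s_n\to\infty$ as $n\to\infty$. Let $b=(b_n)$ be either a fixed real number or a sequence with $b_n\to+\infty$ or $b_n\to-\infty$. Let \[ \Theta_b=\Big\{\theta\in\mathbb R^n:\ |S_\theta|=s_n,\ |\theta_i|\ge\sqrt{2\log(n/s_n)}+b_n\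 \text{ for all } i\in S_\theta\Big\}, \] and let $B=(B_n)$ satisfy $B_n\in[2,e^{(\log(n/s_n))^{1/4}}]$ for all large $n$. Let $\mathcal S_B(\Theta_b)$ be the set of sequences of procedures $\varphi=(\varphi^{(n)})_n$ that are sparsity-preserving, i.e. $\sup_{\theta\in\Theta_b}P_\theta[\sum_i\varphi^{(n)}_i(X)>B_ns_n]\to0$. Let $\overline\Phi$ be the standard Gaussian tail probability. Then \[ \inf_{\varphi\in\mathcal S_B(\Theta_b)}\ \sup_{\theta\in\Theta_b}\mathrm{FNR}(\theta,\varphi)=\overline\Phi(b)+o(1), \] in the following sense: (1) every $\varphi\in\mathcal S_B(\Theta_b)$ satisfies $\liminf_n\big[\sup_{\theta\in\Theta_b}\mathrm{FNR}(\theta,\varphi)-\overline\Phi(b_n)\big]\ge0$; (2) some $\varphi\in\mathcal S_B(\Theta_b)$ satisfies $\sup_{\theta\in\Theta_b}\mathrm{FNR}(\theta,\varphi)=\overline\Phi(b_n)+o(1)$. Hence optimal sparsity-preserving procedures have vanishing FDR, in the following sense: (3) every $\varphi\in\mathcal S_B(\Theta_b)$ satisfies $\liminf_n\big[\sup_{\theta\in\Theta_b}\mathfrak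 R(\theta,\varphi)-\overline\Phi(b_n)-\inf_{\theta\in\Theta_b}\mathrm{FDR}(\theta,\varphi)\big]\ge0$; (4) if $\varphi\in\mathcal S_B(\Theta_b)$ is asymptotically minimax for the combined risk, that is, $\sup_{\theta\in\Theta_b}\mathfrak R(\theta,\varphi)=\inf_\psi\sup_{\theta\in\Theta_b}\mathfrak R(\theta,\psi)+o(1)$ with the infimum over all procedures $\psi$, then $\sup_{\theta\in\Theta_b}\mathrm{FNR}(\theta,\varphi)=\overline\Phi(b_n)+o(1)$, $\inf_{\theta\in\Theta_b}\mathrm{FDR}(\theta,\varphi)\to0$, and $\mathrm{FDR}(\theta^{(n)},\varphi)\to0$ along every sequence $\theta^{(n)}\in\Theta_b$ with $\mathrm{FNR}(\theta^{(n)},\varphi)=\overline\Phi(b_n)+o(1)$. -/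

import Mathlib

open MeasureTheory ProbabilityTheory Filter Topology

noncomputable section

namespace SparseTesting

/-- A multiple testing procedure on `ℝⁿ`: a measurable map `x ↦ (φᵢ(x))ᵢ ∈ {0,1}ⁿ`, where the value
`true` at `i` means that the null hypothesis `θᵢ = 0` is rejected. -/
structure Procedure (n : ℕ) where
  reject : (Fin n → ℝ) → Fin n → Bool
  measurable_reject : Measurable reject

/-- The law `P_θ` of `X = θ + ε`, where `ε₁, …, εₙ` are i.i.d. standard Gaussian. -/
def law {n : ℕ} (θ : Fin n → ℝ) : Measure (Fin n → ℝ) :=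
  Measure.pi fun i => gaussianReal (θ i) 1

/-- The support of `θ`. -/
def supp {n : ℕ} (θ : Fin n → ℝ) : Finset (Fin n) :=
  Finset.univ.filter fun i => θ i ≠ 0

namespace Procedure

/-- Total number of rejections. -/
def numRejections {n : ℕ} (φ : Procedure n) (x : Fin n → ℝ) : ℕ :=
  (Finset.univ.filter fun i => φ.reject x i = true).card

/-- Number of rejected true null hypotheses. -/
def numFalseDiscoveries {n : ℕ} (φ : Procedure n) (θ x : Fin n → ℝ) : ℕ :=
  (Finset.univ.filter fun i => θ i = 0 ∧ φ.reject x i = true).card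

/-- Number of false null hypotheses that are not rejected. -/
def numFalseNegatives {n : ℕ} (φ : Procedure n) (θ x : Fin n → ℝ) : ℕ :=
  (Finset.univ.filter fun i => θ i ≠ 0 ∧ φ.reject x i = false).card

/-- False discovery rate. -/
def FDR {n : ℕ} (θ : Fin n → ℝ) (φ : Procedure n) : ℝ :=
  ∫ x, (φ.numFalseDiscoveries θ x : ℝ) / max 1 (φ.numRejections x : ℝ) ∂(law θ)

/-- False negative rate. -/
def FNR {n : ℕ} (θ : Fin n → ℝ) (φ : Procedure n) : ℝ :=
  ∫ x, (φ.numFalseNegatives θ x : ℝ) / max 1 ((supp θ).card : ℝ) ∂(law θ)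

/-- Combined risk `FDR + FNR`. -/
def risk {n : ℕ} (θ : Fin n → ℝ) (φ : Procedure n) : ℝ :=
  FDR θ φ + FNR θ φ

end Procedure

/-- The beta-min class `Θ(a, s)` of vectors with exactly `s` nonzero coordinates, each of absolute
value at least `a`. -/
def betaMin (n s : ℕ) (a : ℝ) : Set (Fin n → ℝ) :=
  {θ | (supp θ).card = s ∧ ∀ i ∈ supp θ, a ≤ |θ i|}

/-- The class `Θ_b = Θ(√(2 log (n/s)) + b, s)`. -/
def boundaryClass (n s : ℕ) (b : ℝ) : Set (Fin n → ℝ) :=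
  betaMin n s (Real.sqrt (2 * Real.log ((n : ℝ) / s)) + b)

/-- `sup_{θ ∈ Θ} FNR(θ, φ)`. -/
def supFNR {n : ℕ} (Θ : Set (Fin n → ℝ)) (φ : Procedure n) : ℝ :=
  ⨆ θ : Θ, Procedure.FNR (θ : Fin n → ℝ) φ

/-- `sup_{θ ∈ Θ} (FDR + FNR)(θ, φ)`. -/
def supRisk {n : ℕ} (Θ : Set (Fin n → ℝ)) (φ : Procedure n) : ℝ :=
  ⨆ θ : Θ, Procedure.risk (θ : Fin n → ℝ) φ

/-- `inf_{θ ∈ Θ} FDR(θ, φ)`. -/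
def infFDR {n : ℕ} (Θ : Set (Fin n → ℝ)) (φ : Procedure n) : ℝ :=
  ⨅ θ : Θ, Procedure.FDR (θ : Fin n → ℝ) φ

/-- The minimax combined risk over `Θ`, the infimum being over all procedures. -/
def minimaxRisk {n : ℕ} (Θ : Set (Fin n → ℝ)) : ℝ :=
  ⨅ φ : Procedure n, supRisk Θ φ

/-- The set of sequences of procedures that are sparsity-preserving over `Θ = (Θₙ)ₙ` up to the
multiplicative factor `A = (Aₙ)ₙ`. -/
def sparsityPreserving (s : ℕ → ℕ) (Θ : ∀ n, Set (Fin n → ℝ)) (A : ℕ → ℝ) :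
    Set (∀ n, Procedure n) :=
  {φ | Tendsto
    (fun n => ⨆ θ : Θ n, (law (θ : Fin n → ℝ)).real
      {x | A n * (s n : ℝ) < ((φ n).numRejections x : ℝ)}) atTop (𝓝 0)}

/-- A sequence of procedures whose worst-case combined risk over `Θₙ` is asymptotically the
minimax one. -/
def IsAsympMinimax (Θ : ∀ n, Set (Fin n → ℝ)) (φ : ∀ n, Procedure n) : Prop :=
  Tendsto (fun n => supRisk (Θ n) (φ n) - minimaxRisk (Θ n)) atTop (𝓝 0)

/-- Standard Gaussian tail probability `Φ̄ = 1 - Φ`. -/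
def gaussianTail (x : ℝ) : ℝ := 1 - cdf (gaussianReal 0 1) x

end SparseTesting

end

noncomputable section

namespace SparseTesting

/-! ### Gaussian tails -/

/-! Lower bound: average over all supports `S` of size `s`, with every signal equal to `a = t + b`,
`t = √(2 log (n/s))`. Deleting one signal `i ∈ S` costs a likelihood ratio of at most `exp (a τ - a²
/ 2)` on `{xᵢ ≤ τ}` (`law_inter_le`). The rejection of `i` is thereby compared with a false
rejection under the support `S \ {i}`, and on the event of at most `K = B s` rejections the
probabilities of these, summed over `i`, are at most `K`. So `exists_le_FNR` loses only `Φ̄(τ - a)`,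
the probability of exceeding `K`, and `exp (a τ - a² / 2) K / (n - s + 1)`. At `τ = t - δ` the first
loss is `1 - Φ̄(b + δ)`. The last is of order `B exp (-δ t)`, because `exp (t² / 2) = n / s`, and it
vanishes since `B ≤ exp (√t)`. Continuity of `Φ̄` then lets `δ` be small.

Attainment: thresholding `|xᵢ|` at `t` misses each signal with probability at most `Φ̄(b)`, and by
Mills' bound makes at most `2 s / t = o(s)` false discoveries on average. Markov's inequality gives
sparsity preservation. If `b` is bounded below, a fixed fraction of the signals is found
(Chebyshev), so the FDR vanishes too. If `b → -∞`, rejecting nothing already has risk at most `1 =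
Φ̄(b) + o(1)`.

Hence the minimax risk is at most `Φ̄(b) + o(1)`, a level already used up by the worst FNR of a
sparsity-preserving procedure; the claims on the FDR follow by subtraction. -/

lemma gaussianTail_nonneg (x : ℝ) : 0 ≤ gaussianTail x :=
  sub_nonneg.2 (cdf_le_one _ _)

lemma gaussianTail_le_one (x : ℝ) : gaussianTail x ≤ 1 :=
  sub_le_self _ (cdf_nonneg _ _)

lemma gaussianTail_antitone : Antitone gaussianTail := fun _ _ h =>
  sub_le_sub_left (monotone_cdf _ h) _

lemma gaussianTail_tendsto_atTop : Tendsto gaussianTail atTop (𝓝 0) := by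
  have h := (tendsto_cdf_atTop (gaussianReal 0 1)).const_sub 1
  rwa [sub_self] at h

lemma gaussianTail_tendsto_atBot : Tendsto gaussianTail atBot (𝓝 1) := by
  have h := (tendsto_cdf_atBot (gaussianReal 0 1)).const_sub 1
  rwa [sub_zero] at h

lemma gaussianReal_real_Ioi (a τ : ℝ) :
    (gaussianReal a 1).real (Set.Ioi τ) = gaussianTail (τ - a) := by
  have h : gaussianReal a 1 = (gaussianReal 0 1).map (fun x => a + x) := by
    rw [gaussianReal_map_const_add]; simp
  rw [h, map_measureReal_apply (by fun_prop) measurableSet_Ioi, gaussianTail, cdf_eq_real,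
    ← probReal_compl_eq_one_sub measurableSet_Iic]
  congr 1
  ext x
  simp [sub_lt_iff_lt_add']

lemma gaussianReal_real_Iio (a τ : ℝ) :
    (gaussianReal a 1).real (Set.Iio τ) = gaussianTail (a - τ) := by
  have h : gaussianReal a 1 = (gaussianReal (-a) 1).map (fun x => -x) := by
    rw [gaussianReal_map_neg]; simp
  rw [h, map_measureReal_apply (by fun_prop) measurableSet_Iio]
  have : (fun x : ℝ => -x) ⁻¹' Set.Iio τ = Set.Ioi (-τ) := by
    ext x; simp
  rw [this, gaussianReal_real_Ioi]
  congr 1; ring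

lemma gaussianReal_real_Ici (a τ : ℝ) :
    (gaussianReal a 1).real (Set.Ici τ) = gaussianTail (τ - a) := by
  rw [← gaussianReal_real_Ioi]
  have := nullSingletonClass_gaussianReal (μ := a) (v := 1) one_ne_zero
  exact measureReal_congr Ioi_ae_eq_Ici.symm

lemma gaussianReal_real_Iic (a τ : ℝ) :
    (gaussianReal a 1).real (Set.Iic τ) = gaussianTail (a - τ) := by
  rw [← gaussianReal_real_Iio]
  have := nullSingletonClass_gaussianReal (μ := a) (v := 1) one_ne_zero
  exact measureReal_congr Iio_ae_eq_Iic.symm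

lemma gaussianTail_neg (x : ℝ) : gaussianTail (-x) = 1 - gaussianTail x := by
  have h := gaussianReal_real_Iic 0 x
  rw [zero_sub] at h
  rw [← h, gaussianTail, cdf_eq_real]
  ring

/-- A cdf is right continuous; the reflection `x ↦ -x` turns this into left continuity. -/
lemma gaussianTail_continuous : Continuous gaussianTail := by
  have hr : ∀ x, ContinuousWithinAt gaussianTail (Set.Ici x) x := fun x =>
    continuousWithinAt_const.sub ((cdf (gaussianReal 0 1)).right_continuous x)
  refine continuous_iff_continuousAt.2 fun x => continuousAt_iff_continuous_left_right.2 ⟨?_, hr x⟩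
  have h2 : gaussianTail = fun y => 1 - gaussianTail (-y) := by
    funext y; rw [gaussianTail_neg]; ring
  have h3 : ContinuousWithinAt (fun y => gaussianTail (-y)) (Set.Iic x) x :=
    ContinuousWithinAt.comp (g := gaussianTail) (t := Set.Ici (-x)) (hr (-x))
      continuous_neg.continuousWithinAt fun y (hy : y ≤ x) => by simpa using hy
  rw [h2]
  exact continuousWithinAt_const.sub h3

lemma gaussianTail_lt_one (x : ℝ) : gaussianTail x < 1 := by
  have h : 0 < (gaussianReal 0 1).real (Set.Iic x) := by
    rw [measureReal_def]
    refine ENNReal.toReal_pos (fun h0 => ?_) (measure_ne_top _ _)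
    have := gaussianReal_absolutelyContinuous' 0 (v := 1) one_ne_zero h0
    simp at this
  rw [gaussianTail, cdf_eq_real]
  linarith

/-- Mills' bound. -/
lemma gaussianTail_le_exp_div {t : ℝ} (ht : 0 < t) :
    gaussianTail t ≤ Real.exp (-t ^ 2 / 2) / t := by
  have hd : ∀ x ∈ Set.Ici t, HasDerivAt (fun x : ℝ => -Real.exp (-x ^ 2 / 2) / t)
      (x * Real.exp (-x ^ 2 / 2) / t) x := by
    intro x _
    have h1 : HasDerivAt (fun x : ℝ => -x ^ 2 / 2) (-x) x := by
      have := ((hasDerivAt_pow 2 x).neg).div_const 2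
      convert! this using 1
      push_cast; ring
    have := (h1.exp.neg).div_const t
    convert! this using 1
    ring
  have hlim : Tendsto (fun x : ℝ => -Real.exp (-x ^ 2 / 2) / t) atTop (𝓝 0) := by
    have h1 : Tendsto (fun x : ℝ => x ^ 2 / 2) atTop atTop :=
      (tendsto_pow_atTop two_ne_zero).atTop_div_const two_pos
    have h2 := ((Real.tendsto_exp_neg_atTop_nhds_zero.comp h1).neg).div_const t
    simpa [Function.comp_def, neg_div] using h2
  have hpos : ∀ x ∈ Set.Ioi t, 0 ≤ x * Real.exp (-x ^ 2 / 2) / t := fun x hx => by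
    have : 0 < x := ht.trans hx
    positivity
  have hint := integrableOn_Ioi_deriv_of_nonneg' hd hpos hlim
  have hval := integral_Ioi_of_hasDerivAt_of_nonneg' hd hpos hlim
  have h0 := gaussianReal_real_Ioi 0 t
  rw [sub_zero] at h0
  rw [← h0, measureReal_def, gaussianReal_apply_eq_integral 0 one_ne_zero,
    ENNReal.toReal_ofReal (integral_nonneg fun x => gaussianPDFReal_nonneg _ _ _)]
  calc ∫ x in Set.Ioi t, gaussianPDFReal 0 1 x
      ≤ ∫ x in Set.Ioi t, x * Real.exp (-x ^ 2 / 2) / t := by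
        refine setIntegral_mono_on (integrable_gaussianPDFReal 0 1).integrableOn hint
          measurableSet_Ioi fun x hx => ?_
        have hx' : t < x := hx
        -- The normalising constant is simply dropped, and the factor `x / t ≥ 1` makes the
        -- integrand an exact derivative.
        have h1 : (√(2 * Real.pi * 1))⁻¹ ≤ 1 := by
          apply inv_le_one_of_one_le₀
          rw [Real.one_le_sqrt]
          nlinarith [Real.pi_gt_three]
        have h2 : 1 ≤ x / t := (one_le_div ht).2 hx'.le
        calc gaussianPDFReal 0 1 x = (√(2 * Real.pi * 1))⁻¹ * Real.exp (-x ^ 2 / 2) := by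
              simp [gaussianPDFReal]
          _ ≤ x / t * Real.exp (-x ^ 2 / 2) := by
              gcongr; exact h1.trans h2
          _ = _ := by ring
    _ = _ := by rw [hval]; ring

lemma gaussianReal_real_le_abs_le {t : ℝ} (ht : 0 < t) :
    (gaussianReal 0 1).real {x | t ≤ |x|} ≤ 2 * (Real.exp (-t ^ 2 / 2) / t) := by
  have h : {x : ℝ | t ≤ |x|} = Set.Ici t ∪ Set.Iic (-t) := by
    ext x; simp [le_abs, le_neg]
  rw [h]
  refine (measureReal_union_le _ _).trans ?_
  rw [gaussianReal_real_Ici, gaussianReal_real_Iic]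
  have := gaussianTail_le_exp_div ht
  simp only [sub_zero, zero_sub, neg_neg]
  linarith

/-- Only the barrier on the side of the sign of `a` is kept; the other one can only lower the
probability. -/
lemma gaussianReal_real_abs_lt_le {t b a : ℝ} (h : t + b ≤ |a|) :
    (gaussianReal a 1).real {x | |x| < t} ≤ gaussianTail b := by
  rcases le_abs.1 h with h | h
  · refine (measureReal_mono (s₂ := Set.Iio t) fun x hx => (le_abs_self x).trans_lt hx).trans ?_
    rw [gaussianReal_real_Iio]
    exact gaussianTail_antitone (by linarith)
  · refine (measureReal_mono (s₂ := Set.Ioi (-t)) fun x (hx : |x| < t) => (abs_lt.1 hx).1).trans ?_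
    rw [gaussianReal_real_Ioi]
    exact gaussianTail_antitone (by linarith)

/-- Change of the mean of a Gaussian, below a level. -/
lemma gaussianReal_restrict_Iic_le {a : ℝ} (ha : 0 ≤ a) (τ : ℝ) :
    (gaussianReal a 1).restrict (Set.Iic τ) ≤
      ENNReal.ofReal (Real.exp (a * τ - a ^ 2 / 2)) • gaussianReal 0 1 := by
  rw [gaussianReal_of_var_ne_zero _ one_ne_zero, gaussianReal_of_var_ne_zero _ one_ne_zero,
    restrict_withDensity measurableSet_Iic, ← withDensity_smul _ (measurable_gaussianPDF 0 1),
    ← withDensity_indicator measurableSet_Iic]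
  refine withDensity_mono (ae_of_all _ fun x => ?_)
  by_cases hx : x ∈ Set.Iic τ
  · rw [Set.indicator_of_mem hx]
    have hx' : x ≤ τ := hx
    simp only [gaussianPDF, Pi.smul_apply, smul_eq_mul]
    rw [← ENNReal.ofReal_mul (Real.exp_pos _).le]
    refine ENNReal.ofReal_le_ofReal ?_
    simp only [gaussianPDFReal, NNReal.coe_one, sub_zero]
    rw [mul_left_comm, ← Real.exp_add]
    gcongr
    -- The likelihood ratio at `x` is `exp (a x - a² / 2)`, nondecreasing in `x` because `a ≥ 0`,
    -- hence at most its value at `τ`.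
    nlinarith [mul_le_mul_of_nonneg_left hx' ha]
  · simp [Set.indicator_of_notMem hx]

/-! ### The Gaussian product law -/

instance {n : ℕ} (θ : Fin n → ℝ) : IsProbabilityMeasure (law θ) := by
  unfold law; infer_instance

lemma law_eval_real {n : ℕ} (θ : Fin n → ℝ) (i : Fin n) {A : Set ℝ} (hA : MeasurableSet A) :
    (law θ).real {x | x i ∈ A} = (gaussianReal (θ i) 1).real A := by
  rw [← (measurePreserving_eval (fun i => gaussianReal (θ i) 1) i).measureReal_preimage
    hA.nullMeasurableSet]
  rfl

/-- Removing one coordinate of the mean changes the probability of an event by at most a bounded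
factor, away from large values of that coordinate. -/
lemma law_inter_le {n : ℕ} {θ θ' : Fin n → ℝ} {i : Fin n} (hi : 0 ≤ θ i) (hi' : θ' i = 0)
    (h : ∀ j, j ≠ i → θ j = θ' j) (τ : ℝ) {A : Set (Fin n → ℝ)} (hA : MeasurableSet A) :
    (law θ).real (A ∩ {x | x i ≤ τ}) ≤
      Real.exp (θ i * τ - θ i ^ 2 / 2) * (law θ').real A := by
  obtain _ | n := n
  · exact i.elim0
  set e := MeasurableEquiv.piFinSuccAbove (fun _ : Fin (n + 1) => ℝ) i
  -- Integrating over coordinate `i` last leaves the same inner product measure for both means, so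
  -- only the one-dimensional comparison is needed.
  have key : ∀ (η : Fin (n + 1) → ℝ) {C : Set (Fin (n + 1) → ℝ)}, MeasurableSet C →
      law η C = ∫⁻ x, Measure.pi (fun j => gaussianReal (η (i.succAbove j)) 1)
        (Prod.mk x ⁻¹' (e.symm ⁻¹' C)) ∂(gaussianReal (η i) 1) := by
    intro η C hC
    have hp := (measurePreserving_piFinSuccAbove (fun j => gaussianReal (η j) 1) i).symm
    rw [← Measure.prod_apply (e.symm.measurable hC), law]
    exact (hp.measure_preimage hC.nullMeasurableSet).symm
  have hrest : (fun j => gaussianReal (θ (i.succAbove j)) 1) =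
      fun j => gaussianReal (θ' (i.succAbove j)) 1 := by
    funext j; rw [h _ (Fin.succAbove_ne i j)]
  have hm : MeasurableSet {x : Fin (n + 1) → ℝ | x i ≤ τ} :=
    measurableSet_le (measurable_pi_apply i) measurable_const
  have hle : law θ (A ∩ {x | x i ≤ τ}) ≤
      ENNReal.ofReal (Real.exp (θ i * τ - θ i ^ 2 / 2)) * law θ' A := by
    rw [key θ (hA.inter hm), key θ' hA, hrest, hi', ← smul_eq_mul, ← lintegral_smul_measure]
    refine le_trans ?_ (lintegral_mono' (gaussianReal_restrict_Iic_le hi τ) le_rfl)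
    rw [← lintegral_indicator measurableSet_Iic]
    refine lintegral_mono fun x => ?_
    by_cases hx : x ∈ Set.Iic τ
    · rw [Set.indicator_of_mem hx]
      exact measure_mono fun y hy => hy.1
    · rw [Set.indicator_of_notMem hx]
      refine le_of_eq (measure_mono_null (t := ∅) ?_ measure_empty)
      rintro y ⟨-, hy⟩
      have hxe : e.symm (x, y) i = x := by simp [e]
      simp only [Set.mem_ofPred_eq, hxe] at hy
      exact hx hy
  rw [measureReal_def, measureReal_def, ← ENNReal.toReal_ofReal (Real.exp_pos _).le,
    ← ENNReal.toReal_mul]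
  exact ENNReal.toReal_mono (by finiteness) hle

/-! ### Elementary facts on procedures and their risks -/

lemma mem_supp {n : ℕ} {θ : Fin n → ℝ} {i : Fin n} : i ∈ supp θ ↔ θ i ≠ 0 := by
  simp [supp]

namespace Procedure

variable {n : ℕ} (φ : Procedure n) (θ : Fin n → ℝ)

lemma measurableSet_reject_eq (i : Fin n) (v : Bool) : MeasurableSet {x | φ.reject x i = v} :=
  ((measurable_pi_apply i).comp φ.measurable_reject) (measurableSet_singleton v)

/-- The indicator that the procedure takes the value `v` on the `i`-th null hypothesis. -/
def indicator (i : Fin n) (v : Bool) : (Fin n → ℝ) → ℝ :=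
  Set.indicator {x | φ.reject x i = v} 1

lemma indicator_apply (i : Fin n) (v : Bool) (x : Fin n → ℝ) :
    φ.indicator i v x = if φ.reject x i = v then 1 else 0 := by
  simp [indicator, Set.indicator_apply]

lemma indicator_nonneg (i : Fin n) (v : Bool) (x : Fin n → ℝ) : 0 ≤ φ.indicator i v x := by
  rw [indicator_apply]; split_ifs <;> norm_num

lemma indicator_le_one (i : Fin n) (v : Bool) (x : Fin n → ℝ) : φ.indicator i v x ≤ 1 := by
  rw [indicator_apply]; split_ifs <;> norm_num

lemma measurable_indicator (i : Fin n) (v : Bool) : Measurable (φ.indicator i v) :=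
  measurable_one.indicator (φ.measurableSet_reject_eq i v)

lemma integrable_indicator (i : Fin n) (v : Bool) (μ : Measure (Fin n → ℝ)) [IsFiniteMeasure μ] :
    Integrable (φ.indicator i v) μ :=
  (integrable_const (1 : ℝ)).indicator (φ.measurableSet_reject_eq i v)

lemma integral_indicator (i : Fin n) (v : Bool) (μ : Measure (Fin n → ℝ)) :
    ∫ x, φ.indicator i v x ∂μ = μ.real {x | φ.reject x i = v} :=
  integral_indicator_one (φ.measurableSet_reject_eq i v)

lemma numRejections_eq_sum (x : Fin n → ℝ) :
    (φ.numRejections x : ℝ) = ∑ i, φ.indicator i true x := by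
  simp [numRejections, indicator_apply]

lemma numFalseDiscoveries_eq_sum (x : Fin n → ℝ) :
    (φ.numFalseDiscoveries θ x : ℝ) = ∑ i ∈ (supp θ)ᶜ, φ.indicator i true x := by
  simp only [numFalseDiscoveries, indicator_apply, Finset.sum_boole, Nat.cast_inj]
  congr 1
  ext i
  simp [mem_supp]

lemma numFalseNegatives_eq_sum (x : Fin n → ℝ) :
    (φ.numFalseNegatives θ x : ℝ) = ∑ i ∈ supp θ, φ.indicator i false x := by
  simp only [numFalseNegatives, indicator_apply, Finset.sum_boole, Nat.cast_inj]
  congr 1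
  ext i
  simp [mem_supp]

/-- Number of rejected false null hypotheses. -/
def numTrueDiscoveries (x : Fin n → ℝ) : ℝ := ∑ i ∈ supp θ, φ.indicator i true x

lemma numRejections_eq_add (x : Fin n → ℝ) :
    (φ.numRejections x : ℝ) = φ.numTrueDiscoveries θ x + φ.numFalseDiscoveries θ x := by
  rw [numRejections_eq_sum, numFalseDiscoveries_eq_sum, numTrueDiscoveries,
    Finset.sum_add_sum_compl]

lemma numTrueDiscoveries_nonneg (x : Fin n → ℝ) : 0 ≤ φ.numTrueDiscoveries θ x :=
  Finset.sum_nonneg fun i _ => φ.indicator_nonneg i true x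

lemma numTrueDiscoveries_le (x : Fin n → ℝ) : φ.numTrueDiscoveries θ x ≤ (supp θ).card := by
  refine (Finset.sum_le_sum fun i _ => φ.indicator_le_one i true x).trans ?_
  simp

lemma numFalseDiscoveries_le_numRejections (x : Fin n → ℝ) :
    (φ.numFalseDiscoveries θ x : ℝ) ≤ φ.numRejections x := by
  rw [numRejections_eq_add φ θ]
  linarith [φ.numTrueDiscoveries_nonneg θ x]

lemma measurable_numRejections : Measurable fun x => (φ.numRejections x : ℝ) := by
  simp only [numRejections_eq_sum]
  exact Finset.measurable_sum _ fun i _ => φ.measurable_indicator i true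

lemma measurable_numFalseDiscoveries : Measurable fun x => (φ.numFalseDiscoveries θ x : ℝ) := by
  simp only [numFalseDiscoveries_eq_sum]
  exact Finset.measurable_sum _ fun i _ => φ.measurable_indicator i true

lemma measurable_numTrueDiscoveries : Measurable (φ.numTrueDiscoveries θ) :=
  Finset.measurable_sum _ fun i _ => φ.measurable_indicator i true

lemma integrable_numFalseDiscoveries (μ : Measure (Fin n → ℝ)) [IsFiniteMeasure μ] :
    Integrable (fun x => (φ.numFalseDiscoveries θ x : ℝ)) μ := by
  simp only [numFalseDiscoveries_eq_sum]
  exact integrable_finsetSum _ fun i _ => φ.integrable_indicator i true μ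

lemma integral_numFalseDiscoveries (μ : Measure (Fin n → ℝ)) [IsFiniteMeasure μ] :
    ∫ x, (φ.numFalseDiscoveries θ x : ℝ) ∂μ =
      ∑ i ∈ (supp θ)ᶜ, μ.real {x | φ.reject x i = true} := by
  simp only [numFalseDiscoveries_eq_sum]
  rw [integral_finsetSum _ fun i _ => φ.integrable_indicator i true μ]
  simp only [integral_indicator]

lemma integral_numTrueDiscoveries (μ : Measure (Fin n → ℝ)) [IsFiniteMeasure μ] :
    ∫ x, φ.numTrueDiscoveries θ x ∂μ = ∑ i ∈ supp θ, μ.real {x | φ.reject x i = true} := by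
  simp only [numTrueDiscoveries]
  rw [integral_finsetSum _ fun i _ => φ.integrable_indicator i true μ]
  simp only [integral_indicator]

lemma FNR_eq_sum :
    FNR θ φ = (∑ i ∈ supp θ, (law θ).real {x | φ.reject x i = false}) /
      max 1 ((supp θ).card : ℝ) := by
  rw [FNR, integral_div]
  congr 1
  simp only [numFalseNegatives_eq_sum]
  rw [integral_finsetSum _ fun i _ => φ.integrable_indicator i false _]
  simp only [integral_indicator]

lemma real_reject_eq_false (μ : Measure (Fin n → ℝ)) [IsProbabilityMeasure μ] (i : Fin n) :
    μ.real {x | φ.reject x i = false} = 1 - μ.real {x | φ.reject x i = true} := by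
  rw [← probReal_compl_eq_one_sub (φ.measurableSet_reject_eq i true)]
  congr 1
  ext x
  simp

lemma FNR_nonneg : 0 ≤ FNR θ φ := integral_nonneg fun x => by positivity

lemma FDR_nonneg : 0 ≤ FDR θ φ := integral_nonneg fun x => by positivity

lemma FNR_le_one : FNR θ φ ≤ 1 := by
  rw [FNR_eq_sum]
  refine div_le_one_of_le₀ ?_ (by positivity)
  refine (Finset.sum_le_sum fun i _ => measureReal_le_one).trans ?_
  simp

lemma fdp_le_one (x : Fin n → ℝ) :
    (φ.numFalseDiscoveries θ x : ℝ) / max 1 (φ.numRejections x : ℝ) ≤ 1 :=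
  div_le_one_of_le₀ ((φ.numFalseDiscoveries_le_numRejections θ x).trans (le_max_right _ _))
    (by positivity)

lemma integrable_fdp (μ : Measure (Fin n → ℝ)) [IsFiniteMeasure μ] :
    Integrable (fun x => (φ.numFalseDiscoveries θ x : ℝ) / max 1 (φ.numRejections x : ℝ)) μ := by
  refine Integrable.of_bound (C := 1) ?_ (ae_of_all _ fun x => ?_)
  · exact ((φ.measurable_numFalseDiscoveries θ).div
      (measurable_const.max φ.measurable_numRejections)).aestronglyMeasurable
  · rw [Real.norm_of_nonneg (by positivity)]
    exact φ.fdp_le_one θ x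

lemma FDR_le_one : FDR θ φ ≤ 1 := by
  refine (integral_mono (φ.integrable_fdp θ _) (integrable_const 1) (φ.fdp_le_one θ)).trans ?_
  simp

lemma risk_nonneg : 0 ≤ risk θ φ := add_nonneg (φ.FDR_nonneg θ) (φ.FNR_nonneg θ)

lemma risk_le_two : risk θ φ ≤ 2 := by
  have := φ.FDR_le_one θ
  have := φ.FNR_le_one θ
  unfold risk
  linarith

end Procedure

/-! ### Worst cases over a class -/

section Extrema

variable {n : ℕ} {Θ : Set (Fin n → ℝ)} (φ : Procedure n)

lemma FNR_le_supFNR {θ : Fin n → ℝ} (h : θ ∈ Θ) : Procedure.FNR θ φ ≤ supFNR Θ φ :=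
  le_ciSup (f := fun θ : Θ => Procedure.FNR (θ : Fin n → ℝ) φ)
    ⟨1, by rintro _ ⟨θ, rfl⟩; exact φ.FNR_le_one _⟩ ⟨θ, h⟩

lemma risk_le_supRisk {θ : Fin n → ℝ} (h : θ ∈ Θ) : Procedure.risk θ φ ≤ supRisk Θ φ :=
  le_ciSup (f := fun θ : Θ => Procedure.risk (θ : Fin n → ℝ) φ)
    ⟨2, by rintro _ ⟨θ, rfl⟩; exact φ.risk_le_two _⟩ ⟨θ, h⟩

lemma infFDR_le_FDR {θ : Fin n → ℝ} (h : θ ∈ Θ) : infFDR Θ φ ≤ Procedure.FDR θ φ :=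
  ciInf_le (f := fun θ : Θ => Procedure.FDR (θ : Fin n → ℝ) φ)
    ⟨0, by rintro _ ⟨θ, rfl⟩; exact φ.FDR_nonneg _⟩ ⟨θ, h⟩

lemma infFDR_nonneg : 0 ≤ infFDR Θ φ := Real.iInf_nonneg fun _ => φ.FDR_nonneg _

lemma supRisk_nonneg : 0 ≤ supRisk Θ φ := Real.iSup_nonneg fun _ => φ.risk_nonneg _

lemma supFNR_nonneg : 0 ≤ supFNR Θ φ := Real.iSup_nonneg fun _ => φ.FNR_nonneg _

lemma minimaxRisk_le : minimaxRisk Θ ≤ supRisk Θ φ :=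
  ciInf_le ⟨0, by rintro _ ⟨ψ, rfl⟩; exact supRisk_nonneg ψ⟩ φ

lemma supFNR_le_supRisk : supFNR Θ φ ≤ supRisk Θ φ :=
  Real.iSup_le (fun θ => (le_add_of_nonneg_left (φ.FDR_nonneg _)).trans
    (risk_le_supRisk φ θ.2)) (supRisk_nonneg φ)

/-- At each `θ` the risk is the FNR plus an FDR no smaller than its infimum. This turns the FNR
lower bound into a bound on the combined risk. -/
lemma infFDR_add_supFNR_le_supRisk (h : Θ.Nonempty) :
    infFDR Θ φ + supFNR Θ φ ≤ supRisk Θ φ := by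
  have := h.to_subtype
  rw [← le_sub_iff_add_le']
  refine ciSup_le fun θ => ?_
  have h1 := infFDR_le_FDR φ θ.2
  have h2 := risk_le_supRisk φ θ.2
  unfold Procedure.risk at h2
  linarith

lemma real_le_iSup_real {θ : Fin n → ℝ} (h : θ ∈ Θ) (A : Set (Fin n → ℝ)) :
    (law θ).real A ≤ ⨆ θ : Θ, (law (θ : Fin n → ℝ)).real A :=
  le_ciSup (f := fun θ : Θ => (law (θ : Fin n → ℝ)).real A)
    ⟨1, by rintro _ ⟨θ, rfl⟩; exact measureReal_le_one⟩ ⟨θ, h⟩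

end Extrema

/-! ### The lower bound -/

/-- The vector equal to `a` on `S` and to `0` elsewhere. -/
def spike {n : ℕ} (S : Finset (Fin n)) (a : ℝ) : Fin n → ℝ := fun i => if i ∈ S then a else 0

lemma supp_spike {n : ℕ} (S : Finset (Fin n)) {a : ℝ} (ha : a ≠ 0) : supp (spike S a) = S := by
  ext i
  simp [mem_supp, spike, ha]

lemma spike_mem_betaMin {n : ℕ} (S : Finset (Fin n)) {a : ℝ} (ha : 0 < a) :
    spike S a ∈ betaMin n S.card a := by
  refine ⟨by rw [supp_spike S ha.ne'], fun i hi => ?_⟩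
  rw [supp_spike S ha.ne'] at hi
  simp [spike, hi, le_abs_self]

/-- Double counting: a set with a marked element is the same as a smaller set with a marked outside
point. It converts missed signals into false discoveries. -/
lemma sum_powersetCard_erase {α : Type*} [Fintype α] [DecidableEq α] (k : ℕ)
    (f : Finset α → α → ℝ) :
    ∑ S ∈ Finset.powersetCard (k + 1) Finset.univ, ∑ i ∈ S, f (S.erase i) i =
      ∑ S ∈ Finset.powersetCard k Finset.univ, ∑ i ∈ Sᶜ, f S i := by
  rw [Finset.sum_sigma', Finset.sum_sigma']
  refine Finset.sum_bij' (fun p _ => ⟨p.1.erase p.2, p.2⟩) (fun p _ => ⟨insert p.2 p.1, p.2⟩)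
    ?_ ?_ ?_ ?_ ?_
  · rintro ⟨S, i⟩ h
    simp only [Finset.mem_sigma, Finset.mem_powersetCard_univ] at h
    simp [h.2, h.1]
  · rintro ⟨S, i⟩ h
    simp only [Finset.mem_sigma, Finset.mem_powersetCard_univ, Finset.mem_compl] at h
    simp [h.2, h.1]
  · rintro ⟨S, i⟩ h
    simp only [Finset.mem_sigma] at h
    simp [Finset.insert_erase h.2]
  · rintro ⟨S, i⟩ h
    simp only [Finset.mem_sigma, Finset.mem_compl] at h
    simp [Finset.erase_insert h.2]
  · rintro ⟨S, i⟩ h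
    rfl

namespace Procedure

variable {n : ℕ} (φ : Procedure n)

lemma measurableSet_numRejections_le (K : ℝ) :
    MeasurableSet {x | (φ.numRejections x : ℝ) ≤ K} :=
  measurableSet_le φ.measurable_numRejections measurable_const

/-- The sum of the indicators is at most the rejection count where that count is at most `K`, and
zero elsewhere. -/
lemma sum_real_reject_inter_le (μ : Measure (Fin n → ℝ)) [IsProbabilityMeasure μ] {K : ℝ}
    (hK : 0 ≤ K) (T : Finset (Fin n)) :
    ∑ i ∈ T, μ.real ({x | φ.reject x i = true} ∩ {x | (φ.numRejections x : ℝ) ≤ K}) ≤ K := by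
  have hm := fun i => (φ.measurableSet_reject_eq i true).inter (φ.measurableSet_numRejections_le K)
  have hi : ∀ i ∈ T, Integrable (Set.indicator ({x | φ.reject x i = true} ∩
      {x | (φ.numRejections x : ℝ) ≤ K}) (1 : (Fin n → ℝ) → ℝ)) μ := fun i _ =>
    (integrable_const (1 : ℝ)).indicator (hm i)
  simp_rw [← fun i => integral_indicator_one (μ := μ) (hm i)]
  rw [← integral_finsetSum _ hi]
  refine (integral_mono (integrable_finsetSum _ hi) (integrable_const K) fun x => ?_).trans ?_
  · by_cases hx : (φ.numRejections x : ℝ) ≤ K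
    · refine le_trans ?_ hx
      rw [numRejections_eq_sum]
      refine le_trans (Finset.sum_le_sum (g := fun i => φ.indicator i true x) fun i _ => ?_)
        (Finset.sum_le_sum_of_subset_of_nonneg (Finset.subset_univ T)
          fun i _ _ => φ.indicator_nonneg i true x)
      rw [indicator_apply]
      simp [Set.indicator_apply, hx]
    · simpa [Set.indicator_apply, hx] using hK
  · simp

/-- A rejection of `i` comes with too many rejections, or with `xᵢ > τ`, or else lies in the event
where deleting the signal `i` is cheap by `law_inter_le`. -/
lemma real_reject_le_of_spike {S : Finset (Fin n)} {i : Fin n} (hi : i ∈ S) {a : ℝ} (ha : 0 < a)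
    {τ K η : ℝ} (h : (law (spike S a)).real {x | K < (φ.numRejections x : ℝ)} ≤ η) :
    (law (spike S a)).real {x | φ.reject x i = true} ≤
      η + gaussianTail (τ - a) + Real.exp (a * τ - a ^ 2 / 2) *
        (law (spike (S.erase i) a)).real
          ({x | φ.reject x i = true} ∩ {x | (φ.numRejections x : ℝ) ≤ K}) := by
  set A := {x | φ.reject x i = true} ∩ {x | (φ.numRejections x : ℝ) ≤ K}
  have hA : MeasurableSet A :=
    (φ.measurableSet_reject_eq i true).inter (φ.measurableSet_numRejections_le K)
  have hval : spike S a i = a := by simp [spike, hi]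
  have h1 : (law (spike S a)).real {x | φ.reject x i = true} ≤
      (law (spike S a)).real {x | K < (φ.numRejections x : ℝ)} +
      ((law (spike S a)).real {x | x i ∈ Set.Ioi τ} +
        (law (spike S a)).real (A ∩ {x | x i ≤ τ})) := by
    refine le_trans (measureReal_mono fun x hx => ?_)
      ((measureReal_union_le _ _).trans (add_le_add_right (measureReal_union_le _ _) _))
    by_cases h1 : (φ.numRejections x : ℝ) ≤ K
    · by_cases h2 : x i ≤ τ
      · exact Or.inr (Or.inr ⟨⟨hx, h1⟩, h2⟩)
      · exact Or.inr (Or.inl (not_le.1 h2))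
    · exact Or.inl (not_le.1 h1)
  have h2 := law_inter_le (θ := spike S a) (θ' := spike (S.erase i) a) (i := i)
    (by rw [hval]; exact ha.le) (by simp [spike])
    (fun j hj => by simp [spike, hj]) τ hA
  rw [law_eval_real _ _ measurableSet_Ioi, hval, gaussianReal_real_Ioi] at h1
  rw [hval] at h2
  linarith

/-- A procedure with at most `K` rejections, up to probability `η`, has a large false negative rate
at some vector of a beta-min class. -/
lemma exists_le_FNR {k : ℕ} (hk : k + 1 ≤ n) {a : ℝ} (ha : 0 < a) (τ : ℝ) {K η : ℝ} (hK : 0 ≤ K)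
    (h : ∀ θ ∈ betaMin n (k + 1) a, (law θ).real {x | K < (φ.numRejections x : ℝ)} ≤ η) :
    ∃ θ ∈ betaMin n (k + 1) a, 1 - η - gaussianTail (τ - a) -
      Real.exp (a * τ - a ^ 2 / 2) * (K / ((n : ℝ) - k)) ≤ FNR θ φ := by
  set c := Real.exp (a * τ - a ^ 2 / 2)
  set g := gaussianTail (τ - a)
  set P := Finset.powersetCard (k + 1) (Finset.univ : Finset (Fin n))
  have hmem : ∀ S ∈ P, spike S a ∈ betaMin n (k + 1) a := fun S hS => by
    have := spike_mem_betaMin S ha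
    rwa [(Finset.mem_powersetCard_univ.1 hS)] at this
  have hPne : P.Nonempty := Finset.powersetCard_nonempty.2 (by simpa using hk)
  suffices ∃ S ∈ P, 1 - η - g - c * (K / ((n : ℝ) - k)) ≤ FNR (spike S a) φ by
    obtain ⟨S, hS, h'⟩ := this
    exact ⟨_, hmem S hS, h'⟩
  have hk' : (0 : ℝ) < (k : ℝ) + 1 := by positivity
  have hnk : (0 : ℝ) < (n : ℝ) - k := by
    have : ((k + 1 : ℕ) : ℝ) ≤ n := by exact_mod_cast hk
    push_cast at this
    linarith
  -- Some support does at least as well as the average over all of them, that is, the uniform prior.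
  refine Finset.exists_le_of_sum_le hPne ?_
  rw [Finset.sum_const, nsmul_eq_mul, Finset.card_powersetCard, Finset.card_univ,
    Fintype.card_fin, ← mul_le_mul_iff_left₀ hk', Finset.sum_mul]
  have hS : ∀ S ∈ P, ((k : ℝ) + 1) * (1 - η - g) - c * ∑ i ∈ S, (law (spike (S.erase i) a)).real
      ({x | φ.reject x i = true} ∩ {x | (φ.numRejections x : ℝ) ≤ K}) ≤
      FNR (spike S a) φ * ((k : ℝ) + 1) := by
    intro S hS
    have hcard : S.card = k + 1 := Finset.mem_powersetCard_univ.1 hS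
    have hF : FNR (spike S a) φ * ((k : ℝ) + 1) =
        ∑ i ∈ S, (1 - (law (spike S a)).real {x | φ.reject x i = true}) := by
      rw [FNR_eq_sum, supp_spike S ha.ne', hcard]
      push_cast
      rw [max_eq_right (by linarith [(Nat.cast_nonneg k : (0 : ℝ) ≤ k)]), div_mul_cancel₀ _ hk'.ne']
      exact Finset.sum_congr rfl fun i _ => real_reject_eq_false φ _ i
    have hc : ((k : ℝ) + 1) * (1 - η - g) = ∑ i ∈ S, (1 - η - g) := by
      rw [Finset.sum_const, hcard, nsmul_eq_mul]; push_cast; ring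
    rw [hF, hc, Finset.mul_sum, ← Finset.sum_sub_distrib]
    refine Finset.sum_le_sum fun i hi => ?_
    have := φ.real_reject_le_of_spike (τ := τ) hi ha (h _ (hmem S hS))
    linarith
  refine le_trans ?_ (Finset.sum_le_sum hS)
  rw [Finset.sum_sub_distrib, Finset.sum_const, ← Finset.mul_sum,
    sum_powersetCard_erase k fun S i =>
    (law (spike S a)).real ({x | φ.reject x i = true} ∩ {x | (φ.numRejections x : ℝ) ≤ K}),
    nsmul_eq_mul, Finset.card_powersetCard, Finset.card_univ, Fintype.card_fin]
  have hsum : ∑ S ∈ Finset.powersetCard k (Finset.univ : Finset (Fin n)), ∑ i ∈ Sᶜ,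
      (law (spike S a)).real ({x | φ.reject x i = true} ∩ {x | (φ.numRejections x : ℝ) ≤ K}) ≤
      (n.choose k : ℝ) * K := by
    refine (Finset.sum_le_sum fun S _ =>
      φ.sum_real_reject_inter_le (law (spike S a)) hK Sᶜ).trans ?_
    simp
  -- This ratio of binomial coefficients is the source of the denominator `n - k`.
  have hch : (n.choose (k + 1) : ℝ) * ((k : ℝ) + 1) = n.choose k * ((n : ℝ) - k) := by
    have := Nat.choose_succ_right_eq n k
    rw [← Nat.cast_sub (by omega)]
    exact_mod_cast this
  have hc : 0 ≤ c := (Real.exp_pos _).le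
  have heq : (n.choose (k + 1) : ℝ) * (1 - η - g - c * (K / ((n : ℝ) - k))) * ((k : ℝ) + 1) =
      (n.choose (k + 1) : ℝ) * (((k : ℝ) + 1) * (1 - η - g)) - c * (n.choose k * K) := by
    calc _ = (n.choose (k + 1) : ℝ) * (((k : ℝ) + 1) * (1 - η - g)) -
          c * (K / ((n : ℝ) - k)) * (n.choose (k + 1) * ((k : ℝ) + 1)) := by ring
      _ = _ := by rw [hch]; field_simp
  rw [heq]
  exact sub_le_sub_left (mul_le_mul_of_nonneg_left hsum hc) _

end Procedure

/-! ### The threshold procedure -/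

/-- The procedure that rejects the null hypotheses with `|xᵢ| ≥ t`. -/
def threshold (n : ℕ) (t : ℝ) : Procedure n where
  reject x i := decide (t ≤ |x i|)
  measurable_reject := by
    refine measurable_pi_iff.2 fun i => ?_
    have hm : MeasurableSet {x : Fin n → ℝ | t ≤ |x i|} :=
      measurableSet_le measurable_const (measurable_pi_apply i).abs
    exact measurable_to_bool (by simpa [Set.preimage] using hm)

/-- The procedure that rejects nothing. -/
def acceptAll (n : ℕ) : Procedure n where
  reject _ _ := false
  measurable_reject := measurable_const

namespace Procedure

variable {n : ℕ}

lemma risk_acceptAll_le (θ : Fin n → ℝ) : risk θ (acceptAll n) ≤ 1 := by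
  have h : FDR θ (acceptAll n) = 0 := by
    simp [FDR, numFalseDiscoveries, acceptAll]
  rw [risk, h, zero_add]
  exact FNR_le_one _ _

variable (θ : Fin n → ℝ) (t : ℝ)

lemma measurableSet_le_abs : MeasurableSet {y : ℝ | t ≤ |y|} :=
  measurableSet_le measurable_const measurable_abs

lemma law_threshold_true (i : Fin n) :
    (law θ).real {x | (threshold n t).reject x i = true} =
      (gaussianReal (θ i) 1).real {y | t ≤ |y|} := by
  rw [← law_eval_real θ i (measurableSet_le_abs t)]
  simp [threshold]

lemma law_threshold_false (i : Fin n) :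
    (law θ).real {x | (threshold n t).reject x i = false} =
      (gaussianReal (θ i) 1).real {y | |y| < t} := by
  rw [← law_eval_real θ i (measurableSet_lt measurable_abs measurable_const)]
  simp [threshold]

variable {θ t}

lemma FNR_threshold_le {b : ℝ} (h : ∀ i ∈ supp θ, t + b ≤ |θ i|) :
    FNR θ (threshold n t) ≤ gaussianTail b := by
  rw [FNR_eq_sum, div_le_iff₀ (by positivity)]
  refine (Finset.sum_le_card_nsmul _ _ (gaussianTail b) fun i hi => ?_).trans ?_
  · rw [law_threshold_false]
    exact gaussianReal_real_abs_lt_le (h i hi)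
  · rw [nsmul_eq_mul, mul_comm]
    exact mul_le_mul_of_nonneg_left (le_max_right _ _) (gaussianTail_nonneg b)

lemma integral_numFalseDiscoveries_threshold_le (ht : 0 < t) :
    ∫ x, ((threshold n t).numFalseDiscoveries θ x : ℝ) ∂(law θ) ≤
      n * (2 * (Real.exp (-t ^ 2 / 2) / t)) := by
  rw [integral_numFalseDiscoveries]
  refine (Finset.sum_le_card_nsmul _ _ (2 * (Real.exp (-t ^ 2 / 2) / t)) fun i hi => ?_).trans ?_
  · have h0 : θ i = 0 := by simpa [mem_supp] using hi
    rw [law_threshold_true, h0]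
    exact gaussianReal_real_le_abs_le ht
  · rw [nsmul_eq_mul]
    have : (((supp θ)ᶜ.card : ℕ) : ℝ) ≤ n := by
      exact_mod_cast (Finset.card_le_univ _).trans_eq (Fintype.card_fin n)
    gcongr

/-- Markov's inequality for the number of false discoveries. -/
lemma real_lt_numRejections_le {s B : ℝ} (φ : Procedure n) (hs : 0 < s)
    (hcard : ((supp θ).card : ℝ) ≤ s) (hB : 2 ≤ B) :
    (law θ).real {x | B * s < (φ.numRejections x : ℝ)} ≤
      (∫ x, (φ.numFalseDiscoveries θ x : ℝ) ∂(law θ)) / s := by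
  rw [le_div_iff₀ hs, mul_comm]
  refine le_trans (mul_le_mul_of_nonneg_left (measureReal_mono fun x hx => ?_) hs.le)
    (mul_meas_ge_le_integral_of_nonneg (ae_of_all _ fun x => Nat.cast_nonneg _)
      (φ.integrable_numFalseDiscoveries θ _) s)
  have hx' : B * s < (φ.numRejections x : ℝ) := hx
  -- At most `s` rejections are true discoveries, so more than `B s ≥ 2 s` rejections force at least
  -- `s` false ones.
  rw [numRejections_eq_add φ θ] at hx'
  have := φ.numTrueDiscoveries_le θ x
  change s ≤ (φ.numFalseDiscoveries θ x : ℝ)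
  nlinarith

lemma memLp_indicator (φ : Procedure n) (i : Fin n) (v : Bool) (μ : Measure (Fin n → ℝ))
    [IsFiniteMeasure μ] : MemLp (φ.indicator i v) 2 μ :=
  MemLp.of_bound (φ.measurable_indicator i v).aestronglyMeasurable 1 (ae_of_all _ fun x => by
    rw [Real.norm_of_nonneg (φ.indicator_nonneg i v x)]
    exact φ.indicator_le_one i v x)

/-- The rejections depend on separate independent coordinates, so variances add; each is at most
`1/4`, crudely bounded by `1`. -/
lemma variance_numTrueDiscoveries_threshold_le :
    variance ((threshold n t).numTrueDiscoveries θ) (law θ) ≤ (supp θ).card := by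
  have heq : (threshold n t).numTrueDiscoveries θ =
      ∑ i ∈ supp θ, (threshold n t).indicator i true := by
    funext x; simp [numTrueDiscoveries]
  have hind : iIndepFun (fun i => (threshold n t).indicator i true) (law θ) := by
    have h := iIndepFun_pi (μ := fun i => gaussianReal (θ i) 1)
      (X := fun _ : Fin n => Set.indicator {y : ℝ | t ≤ |y|} (1 : ℝ → ℝ))
      fun i => (measurable_one.indicator (measurableSet_le_abs t)).aemeasurable
    convert! h using 2 with i
    funext x
    rw [indicator_apply]
    simp [threshold, Set.indicator_apply]
  rw [heq, IndepFun.variance_sum (fun i _ => (threshold n t).memLp_indicator i true _)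
    fun i _ j _ hij => hind.indepFun hij]
  refine (Finset.sum_le_card_nsmul _ _ 1 fun i _ => ?_).trans (by simp)
  refine (variance_le_sq_of_bounded (a := 0) (b := 1) (ae_of_all _ fun x =>
    ⟨indicator_nonneg _ _ _ _, indicator_le_one _ _ _ _⟩)
    ((threshold n t).measurable_indicator i true).aemeasurable).trans ?_
  norm_num

/-- Chebyshev's inequality for the number of true discoveries. -/
lemma real_numTrueDiscoveries_lt_le {c : ℝ} (hc : 0 < c) (hs : 0 < (supp θ).card)
    (h : ∀ i ∈ supp θ, 2 * c ≤ (gaussianReal (θ i) 1).real {y | t ≤ |y|}) :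
    (law θ).real {x | (threshold n t).numTrueDiscoveries θ x < c * (supp θ).card} ≤
      1 / (c ^ 2 * (supp θ).card) := by
  set T := (threshold n t).numTrueDiscoveries θ
  have hs' : (0 : ℝ) < (supp θ).card := by exact_mod_cast hs
  -- With mean at least `2 c s`, falling below `c s` is a deviation of at least `c s`.
  have hmean : 2 * c * (supp θ).card ≤ ∫ x, T x ∂(law θ) := by
    rw [integral_numTrueDiscoveries, mul_comm, ← nsmul_eq_mul]
    refine Finset.card_nsmul_le_sum _ _ _ fun i hi => ?_
    rw [law_threshold_true]
    exact h i hi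
  have hT : MemLp T 2 (law θ) := memLp_finsetSum _ fun i _ =>
    (threshold n t).memLp_indicator i true _
  have hcheb := meas_ge_le_variance_div_sq hT (c := c * (supp θ).card) (by positivity)
  have h1 : (law θ).real {x | c * (supp θ).card ≤ |T x - ∫ y, T y ∂(law θ)|} ≤
      variance T (law θ) / (c * (supp θ).card) ^ 2 := by
    refine ENNReal.toReal_le_of_le_ofReal (div_nonneg (variance_nonneg _ _) (sq_nonneg _)) hcheb
  refine (measureReal_mono fun x hx => ?_).trans (h1.trans ?_)
  · have hx' : T x < c * (supp θ).card := hx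
    change _ ≤ |T x - ∫ y, T y ∂(law θ)|
    rw [abs_sub_comm]
    refine le_trans ?_ (le_abs_self _)
    linarith
  · rw [div_le_div_iff₀ (by positivity) (by positivity)]
    have := variance_numTrueDiscoveries_threshold_le (θ := θ) (t := t)
    calc _ ≤ ((supp θ).card : ℝ) * (c ^ 2 * (supp θ).card) := by gcongr
      _ = _ := by ring

/-- The false discovery proportion is at most `1` when true discoveries are few; otherwise its
denominator is at least `m`. -/
lemma FDR_le_add {m : ℝ} (hm : 0 < m) (φ : Procedure n) :
    FDR θ φ ≤ (law θ).real {x | φ.numTrueDiscoveries θ x < m} +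
      (∫ x, (φ.numFalseDiscoveries θ x : ℝ) ∂(law θ)) / m := by
  have hmeas : MeasurableSet {x | φ.numTrueDiscoveries θ x < m} :=
    measurableSet_lt (φ.measurable_numTrueDiscoveries θ) measurable_const
  have hi1 : Integrable (Set.indicator {x | φ.numTrueDiscoveries θ x < m}
      (1 : (Fin n → ℝ) → ℝ)) (law θ) := (integrable_const (1 : ℝ)).indicator hmeas
  have hi2 := (φ.integrable_numFalseDiscoveries θ (law θ)).div_const m
  rw [← integral_indicator_one hmeas, ← integral_div, ← integral_add hi1 hi2]
  refine integral_mono (φ.integrable_fdp θ _) (hi1.add hi2) fun x => ?_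
  by_cases hx : φ.numTrueDiscoveries θ x < m
  · have h1 := φ.fdp_le_one θ x
    have h2 : 0 ≤ (φ.numFalseDiscoveries θ x : ℝ) / m := by positivity
    simp only [Set.indicator_apply, Set.mem_ofPred_eq, hx, if_true, Pi.one_apply]
    linarith
  · simp only [Set.indicator_apply, Set.mem_ofPred_eq, hx, if_false, zero_add]
    have h3 : m ≤ max 1 (φ.numRejections x : ℝ) := by
      refine le_trans ?_ (le_max_right _ _)
      rw [numRejections_eq_add φ θ]
      have : (0 : ℝ) ≤ φ.numFalseDiscoveries θ x := Nat.cast_nonneg _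
      linarith [not_lt.1 hx]
    gcongr

lemma FDR_threshold_le {b : ℝ} (ht : 0 < t) (hs : 0 < (supp θ).card)
    (h : ∀ i ∈ supp θ, t + b ≤ |θ i|) {c : ℝ} (hc : 0 < c) (hcb : 2 * c ≤ 1 - gaussianTail b) :
    FDR θ (threshold n t) ≤ 1 / (c ^ 2 * (supp θ).card) +
      n * (2 * (Real.exp (-t ^ 2 / 2) / t)) / (c * (supp θ).card) := by
  have hs' : (0 : ℝ) < (supp θ).card := by exact_mod_cast hs
  refine (FDR_le_add (m := c * (supp θ).card) (by positivity) _).trans (add_le_add ?_ ?_)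
  · refine real_numTrueDiscoveries_lt_le hc hs fun i hi => ?_
    have h1 := gaussianReal_real_abs_lt_le (h i hi)
    have h2 : (gaussianReal (θ i) 1).real {y | t ≤ |y|} =
        1 - (gaussianReal (θ i) 1).real {y | |y| < t} := by
      rw [← probReal_compl_eq_one_sub (measurableSet_lt measurable_abs measurable_const)]
      congr 1
      ext y
      simp
    linarith
  · gcongr
    exact integral_numFalseDiscoveries_threshold_le ht

end Procedure

/-! ### Asymptotics -/

/-- The oracle level `√(2 log (n/s))`. -/
def level (n s : ℕ) : ℝ := Real.sqrt (2 * Real.log ((n : ℝ) / s))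

lemma boundaryClass_eq (n s : ℕ) (b : ℝ) : boundaryClass n s b = betaMin n s (level n s + b) := rfl

lemma betaMin_antitone (n s : ℕ) : Antitone (betaMin n s) := fun _ _ h _ hθ =>
  ⟨hθ.1, fun i hi => h.trans (hθ.2 i hi)⟩

lemma boundaryClass_antitone (n s : ℕ) : Antitone (boundaryClass n s) := fun _ _ h =>
  betaMin_antitone n s (by gcongr)

lemma betaMin_nonempty {n s : ℕ} (h : s ≤ n) (a : ℝ) : (betaMin n s a).Nonempty := by
  obtain ⟨S, -, hS⟩ := Finset.exists_subset_card_eq (s := (Finset.univ : Finset (Fin n)))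
    (n := s) (by simpa using h)
  -- Since `a` may be nonpositive, `max 1 a` keeps the spikes nonzero and the support equal to `S`.
  refine ⟨spike S (max 1 a), betaMin_antitone n s (le_max_right 1 a) ?_⟩
  have := spike_mem_betaMin S (lt_of_lt_of_le one_pos (le_max_left 1 a))
  rwa [hS] at this

lemma exp_level_sq {n s : ℕ} (h : 1 ≤ (n : ℝ) / s) :
    Real.exp (level n s ^ 2 / 2) = (n : ℝ) / s := by
  rw [level, Real.sq_sqrt (mul_nonneg zero_le_two (Real.log_nonneg h)),
    mul_div_cancel_left₀ _ two_ne_zero, Real.exp_log (by linarith)]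

/-- With `L = log (n/s)` the right side is `(2 L)^(1/4)`. The allowed range of `B` is thus at most
`exp (√t)`, negligible against `exp (δ t)`. -/
lemma log_rpow_le_sqrt_level {n s : ℕ} (h : 1 ≤ (n : ℝ) / s) :
    (Real.log ((n : ℝ) / s)) ^ (1 / 4 : ℝ) ≤ Real.sqrt (level n s) := by
  have hl := Real.log_nonneg h
  rw [level, Real.sqrt_eq_rpow, Real.sqrt_eq_rpow, ← Real.rpow_mul (by positivity)]
  norm_num
  gcongr
  linarith

section

variable {s : ℕ → ℕ} {b B : ℕ → ℝ} {Θ : ∀ n, Set (Fin n → ℝ)}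

lemma tendsto_level (hns : Tendsto (fun n : ℕ => (n : ℝ) / (s n : ℝ)) atTop atTop) :
    Tendsto (fun n => level n (s n)) atTop atTop :=
  Real.tendsto_sqrt_atTop.comp
    ((Real.tendsto_log_atTop.comp hns).const_mul_atTop two_pos)

lemma le_of_two_le_div {n k : ℕ} (hk : 0 < k) (h : 2 ≤ (n : ℝ) / k) : 2 * (k : ℝ) ≤ n :=
  (le_div_iff₀ (by exact_mod_cast hk)).1 h

lemma eventually_nonempty (hs : Tendsto s atTop atTop)
    (hns : Tendsto (fun n : ℕ => (n : ℝ) / (s n : ℝ)) atTop atTop)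
    (hΘ : ∀ n, Θ n = boundaryClass n (s n) (b n)) : ∀ᶠ n in atTop, (Θ n).Nonempty := by
  filter_upwards [hs.eventually_ge_atTop 1, hns.eventually_ge_atTop 2] with n h1 h2
  rw [hΘ, boundaryClass_eq]
  have h3 := le_of_two_le_div h1 h2
  have : (0 : ℝ) ≤ s n := Nat.cast_nonneg _
  exact betaMin_nonempty (by exact_mod_cast (by linarith : (s n : ℝ) ≤ n)) _

/-- At a fixed boundary constant, the excess term of the lower bound vanishes. -/
lemma tendsto_exp_mul_sqrt_sub {δ : ℝ} (hδ : 0 < δ) (C : ℝ) :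
    Tendsto (fun t : ℝ => 2 * Real.exp (Real.sqrt t - δ * t + C)) atTop (𝓝 0) := by
  have h1 : Tendsto (fun t : ℝ => Real.sqrt t * (δ * Real.sqrt t - 1) - C) atTop atTop := by
    refine tendsto_atTop_add_const_right _ _ ?_
    exact Real.tendsto_sqrt_atTop.atTop_mul_atTop₀
      (tendsto_atTop_add_const_right _ _ (Real.tendsto_sqrt_atTop.const_mul_atTop hδ))
  have h2 := (Real.tendsto_exp_neg_atTop_nhds_zero.comp h1).const_mul 2
  rw [mul_zero] at h2
  refine h2.congr' ?_
  filter_upwards [eventually_ge_atTop 0] with t ht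
  simp only [Function.comp_apply]
  congr 2
  nlinarith [Real.mul_self_sqrt ht]

lemma exp_mul_div_le {n k : ℕ} {B b δ : ℝ} (hn : 2 ≤ (n : ℝ) / (k + 1 : ℕ))
    (hB : B ≤ Real.exp ((Real.log ((n : ℝ) / (k + 1 : ℕ))) ^ (1 / 4 : ℝ))) :
    let t := level n (k + 1)
    Real.exp ((t + b) * (t - δ) - (t + b) ^ 2 / 2) * (B * (k + 1 : ℕ) / ((n : ℝ) - k)) ≤
      2 * Real.exp (Real.sqrt t - δ * t + (-δ * b - b ^ 2 / 2)) := by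
  intro t
  have hk : (0 : ℝ) < (k + 1 : ℕ) := by positivity
  have h2 := le_of_two_le_div k.succ_pos hn
  have hkk : (k : ℝ) ≤ (k + 1 : ℕ) := by push_cast; linarith
  -- The factor `2` of the conclusion comes from here.
  have hnk : (n : ℝ) / 2 ≤ (n : ℝ) - k := by linarith
  have hn0 : (0 : ℝ) < n := by linarith
  have hB' : B ≤ Real.exp (Real.sqrt t) :=
    hB.trans (Real.exp_le_exp.2 (log_rpow_le_sqrt_level (by linarith)))
  have hE : Real.exp ((t + b) * (t - δ) - (t + b) ^ 2 / 2) =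
      (n : ℝ) / (k + 1 : ℕ) * Real.exp (-δ * t + (-δ * b - b ^ 2 / 2)) := by
    rw [← exp_level_sq (n := n) (s := k + 1) (by linarith), ← Real.exp_add]
    congr 1
    change _ = t ^ 2 / 2 + _
    ring
  have hfrac : B * (k + 1 : ℕ) / ((n : ℝ) - k) ≤
      Real.exp (Real.sqrt t) * (k + 1 : ℕ) / ((n : ℝ) / 2) := by
    have : (0 : ℝ) < (n : ℝ) - k := by linarith
    gcongr
  calc _ ≤ Real.exp ((t + b) * (t - δ) - (t + b) ^ 2 / 2) *
        (Real.exp (Real.sqrt t) * (k + 1 : ℕ) / ((n : ℝ) / 2)) := by gcongr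
    _ = 2 * (Real.exp (Real.sqrt t) * Real.exp (-δ * t + (-δ * b - b ^ 2 / 2))) := by
        rw [hE]
        field_simp
    _ = _ := by
        rw [← Real.exp_add]
        congr 2
        ring

/-- Only an inclusion of the class at a fixed `b₀` is required, so that both fixed `b` and `b → -∞`
are covered. The error `ε` is split equally between the choice of `δ`, the excess term and the
probability of too many rejections. -/
lemma eventually_tail_sub_le_supFNR_of_subset (hs : Tendsto s atTop atTop)
    (hns : Tendsto (fun n : ℕ => (n : ℝ) / (s n : ℝ)) atTop atTop)
    (hB : ∀ᶠ n : ℕ in atTop, 2 ≤ B n ∧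
      B n ≤ Real.exp ((Real.log ((n : ℝ) / (s n : ℝ))) ^ (1 / 4 : ℝ)))
    {b₀ : ℝ} (hΘ : ∀ᶠ n in atTop, boundaryClass n (s n) b₀ ⊆ Θ n)
    {φ : ∀ n, Procedure n} (hφ : φ ∈ sparsityPreserving s Θ B) {ε : ℝ} (hε : 0 < ε) :
    ∀ᶠ n in atTop, gaussianTail b₀ - ε ≤ supFNR (Θ n) (φ n) := by
  obtain ⟨δ, hδ, hδb⟩ : ∃ δ > 0, gaussianTail b₀ - ε / 3 < gaussianTail (b₀ + δ) := by
    have h1 : ∀ᶠ x in 𝓝 b₀, gaussianTail b₀ - ε / 3 < gaussianTail x :=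
      gaussianTail_continuous.continuousAt.eventually_const_lt (by linarith)
    obtain ⟨r, hr, h⟩ := Metric.eventually_nhds_iff.1 h1
    refine ⟨r / 2, by positivity, h ?_⟩
    rw [Real.dist_eq, add_sub_cancel_left, abs_of_pos (by positivity)]
    linarith
  have hlev := tendsto_level hns
  have hex := ((tendsto_exp_mul_sqrt_sub hδ (-δ * b₀ - b₀ ^ 2 / 2)).comp hlev).eventually_le_const
    (show (0 : ℝ) < ε / 3 by positivity)
  have hsp := (show Tendsto _ atTop (𝓝 (0 : ℝ)) from hφ).eventually_le_const
    (show (0 : ℝ) < ε / 3 by positivity)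
  filter_upwards [hex, hsp, hΘ, hB, hs.eventually_ge_atTop 1, hns.eventually_ge_atTop 2,
    hlev.eventually_gt_atTop (-b₀)] with n hex hsp hΘ hB h1 h2 hlev
  obtain ⟨k, hk⟩ : ∃ k, s n = k + 1 := ⟨s n - 1, by omega⟩
  have h3 := le_of_two_le_div h1 h2
  rw [boundaryClass_eq] at hΘ
  simp only [Function.comp_apply] at hex
  rw [hk] at hΘ hB hsp h2 h3 hlev hex
  have hle : k + 1 ≤ n := by
    have : (0 : ℝ) ≤ (k + 1 : ℕ) := Nat.cast_nonneg _
    exact_mod_cast (by linarith : ((k + 1 : ℕ) : ℝ) ≤ n)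
  obtain ⟨θ, hθ, hF⟩ := (φ n).exists_le_FNR (K := B n * (k + 1 : ℕ)) (η := ε / 3) hle
    (by linarith : 0 < level n (k + 1) + b₀) (level n (k + 1) - δ)
    (mul_nonneg (by linarith [hB.1]) (Nat.cast_nonneg _))
    fun θ hθ => (real_le_iSup_real (hΘ hθ) _).trans hsp
  refine le_trans ?_ (FNR_le_supFNR (φ n) (hΘ hθ))
  refine le_trans ?_ hF
  have h4 := exp_mul_div_le (b := b₀) (δ := δ) h2 hB.2
  have h5 : level n (k + 1) - δ - (level n (k + 1) + b₀) = -(b₀ + δ) := by ring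
  rw [h5, gaussianTail_neg]
  simp only at h4
  linarith

/-- The worst-case false negative rate of a sparsity-preserving procedure is asymptotically at
least the Gaussian tail. -/
lemma eventually_tail_sub_le_supFNR (hs : Tendsto s atTop atTop)
    (hns : Tendsto (fun n : ℕ => (n : ℝ) / (s n : ℝ)) atTop atTop)
    (hb : (∃ b₀ : ℝ, ∀ n, b n = b₀) ∨ Tendsto b atTop atTop ∨ Tendsto b atTop atBot)
    (hB : ∀ᶠ n : ℕ in atTop, 2 ≤ B n ∧
      B n ≤ Real.exp ((Real.log ((n : ℝ) / (s n : ℝ))) ^ (1 / 4 : ℝ)))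
    (hΘ : ∀ n, Θ n = boundaryClass n (s n) (b n))
    {φ : ∀ n, Procedure n} (hφ : φ ∈ sparsityPreserving s Θ B) {ε : ℝ} (hε : 0 < ε) :
    ∀ᶠ n in atTop, gaussianTail (b n) - ε ≤ supFNR (Θ n) (φ n) := by
  rcases hb with ⟨b₀, hb⟩ | hb | hb
  · simp only [hb]
    refine eventually_tail_sub_le_supFNR_of_subset hs hns hB
      (Eventually.of_forall fun n => ?_) hφ hε
    rw [hΘ, hb]
  -- For `b → +∞` the target tends to `0`, and nonnegativity of the FNR suffices.
  · filter_upwards [(gaussianTail_tendsto_atTop.comp hb).eventually_le_const hε] with n hn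
    exact le_trans (sub_nonpos.2 hn) (supFNR_nonneg _)
  -- For `b → -∞` the class eventually contains the one at a fixed `b₀` whose tail is already within
  -- `ε / 2` of `1`.
  · obtain ⟨b₀, hb₀⟩ := (gaussianTail_tendsto_atBot.eventually_const_le
      (show 1 - ε / 2 < 1 by linarith)).exists
    have hsub : ∀ᶠ n in atTop, boundaryClass n (s n) b₀ ⊆ Θ n := by
      filter_upwards [hb.eventually_le_atBot b₀] with n hn
      rw [hΘ]
      exact boundaryClass_antitone _ _ hn
    filter_upwards [eventually_tail_sub_le_supFNR_of_subset hs hns hB hsub hφ (half_pos hε)]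
      with n hn
    linarith [gaussianTail_le_one (b n)]

/-! ### Attainment by the oracle threshold -/

/-- The bound on the mean number of false discoveries of the oracle threshold, relative to the
sparsity. -/
lemma level_mul_exp_div {n k : ℕ} (hk : 0 < k) (h : 1 ≤ (n : ℝ) / k) :
    n * (2 * (Real.exp (-level n k ^ 2 / 2) / level n k)) = 2 * k / level n k := by
  have hk' : (0 : ℝ) < k := by exact_mod_cast hk
  have hn : (0 : ℝ) < n := by
    by_contra hn
    have : (n : ℝ) / k ≤ 0 := div_nonpos_of_nonpos_of_nonneg (not_lt.1 hn) hk'.le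
    linarith
  rw [neg_div, Real.exp_neg, exp_level_sq h]
  field_simp

lemma oracle_mem_sparsityPreserving (hs : Tendsto s atTop atTop)
    (hns : Tendsto (fun n : ℕ => (n : ℝ) / (s n : ℝ)) atTop atTop)
    (hB : ∀ᶠ n : ℕ in atTop, 2 ≤ B n)
    (hΘ : ∀ n, Θ n = boundaryClass n (s n) (b n)) :
    (fun n => threshold n (level n (s n))) ∈ sparsityPreserving s Θ B := by
  have hlev := tendsto_level hns
  refine tendsto_of_tendsto_of_tendsto_of_le_of_le' tendsto_const_nhds
    (hlev.const_div_atTop 2) (Eventually.of_forall fun n => Real.iSup_nonneg fun θ =>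
      measureReal_nonneg) ?_
  filter_upwards [hB, hs.eventually_ge_atTop 1, hns.eventually_ge_atTop 1,
    hlev.eventually_gt_atTop 0] with n hB h1 h2 h3
  refine Real.iSup_le (fun θ => ?_) (by positivity)
  have hθ : (θ : Fin n → ℝ) ∈ boundaryClass n (s n) (b n) := hΘ n ▸ θ.2
  have hs0 : (0 : ℝ) < s n := by exact_mod_cast h1
  refine (Procedure.real_lt_numRejections_le _ hs0 (by rw [hθ.1]) hB).trans ?_
  rw [div_le_iff₀ hs0]
  refine (Procedure.integral_numFalseDiscoveries_threshold_le h3).trans_eq ?_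
  rw [level_mul_exp_div h1 h2]
  ring

lemma supFNR_oracle_le (n k : ℕ) (b : ℝ) :
    supFNR (boundaryClass n k b) (threshold n (level n k)) ≤ gaussianTail b :=
  Real.iSup_le (fun θ => Procedure.FNR_threshold_le θ.2.2) (gaussianTail_nonneg b)

/-- The lower bound `b₀` on `b` gives every signal a detection probability of at least `2 c > 0`,
uniformly in `n`; this keeps the denominator of the FDR of order `s`. -/
lemma eventually_supRisk_oracle_le (hs : Tendsto s atTop atTop)
    (hns : Tendsto (fun n : ℕ => (n : ℝ) / (s n : ℝ)) atTop atTop)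
    {b₀ : ℝ} (hb : ∀ᶠ n in atTop, b₀ ≤ b n) {ε : ℝ} (hε : 0 < ε) :
    ∀ᶠ n in atTop, supRisk (boundaryClass n (s n) (b n)) (threshold n (level n (s n))) ≤
      gaussianTail (b n) + ε := by
  have hlev := tendsto_level hns
  set c := (1 - gaussianTail b₀) / 2
  have hc : 0 < c := half_pos (sub_pos.2 (gaussianTail_lt_one b₀))
  have hsr : Tendsto (fun n => (s n : ℝ)) atTop atTop := tendsto_natCast_atTop_atTop.comp hs
  have hlim : Tendsto (fun n => 1 / (c ^ 2 * (s n : ℝ)) + 2 / c / level n (s n)) atTop (𝓝 0) := by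
    have h1 := (hsr.const_mul_atTop (pow_pos hc 2)).const_div_atTop 1
    simpa using h1.add (hlev.const_div_atTop (2 / c))
  filter_upwards [hb, hlim.eventually_le_const hε, hs.eventually_ge_atTop 1,
    hns.eventually_ge_atTop 1, hlev.eventually_gt_atTop 0] with n hb hε' h1 h2 h3
  refine Real.iSup_le (fun θ => ?_) (add_nonneg (gaussianTail_nonneg _) hε.le)
  have hcard : (supp (θ : Fin n → ℝ)).card = s n := θ.2.1
  have hs0 : (0 : ℝ) < s n := by exact_mod_cast h1
  have hF := Procedure.FNR_threshold_le (b := b n) (t := level n (s n)) θ.2.2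
  have hD := Procedure.FDR_threshold_le h3 (by rw [hcard]; exact h1) θ.2.2 hc
    (by have := gaussianTail_antitone hb; simp only [c]; linarith)
  rw [hcard, level_mul_exp_div h1 h2] at hD
  have heq : 2 * (s n : ℝ) / level n (s n) / (c * s n) = 2 / c / level n (s n) := by
    field_simp
  rw [heq] at hD
  unfold Procedure.risk
  linarith

lemma eventually_minimaxRisk_le (hs : Tendsto s atTop atTop)
    (hns : Tendsto (fun n : ℕ => (n : ℝ) / (s n : ℝ)) atTop atTop)
    (hb : (∃ b₀ : ℝ, ∀ n, b n = b₀) ∨ Tendsto b atTop atTop ∨ Tendsto b atTop atBot)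
    (hΘ : ∀ n, Θ n = boundaryClass n (s n) (b n)) {ε : ℝ} (hε : 0 < ε) :
    ∀ᶠ n in atTop, minimaxRisk (Θ n) ≤ gaussianTail (b n) + ε := by
  have key : ∀ b₀, (∀ᶠ n in atTop, b₀ ≤ b n) →
      ∀ᶠ n in atTop, minimaxRisk (Θ n) ≤ gaussianTail (b n) + ε := fun b₀ h => by
    filter_upwards [eventually_supRisk_oracle_le hs hns h hε] with n hn
    rw [hΘ]
    exact (minimaxRisk_le _).trans hn
  rcases hb with ⟨b₀, hb⟩ | hb | hb
  · exact key b₀ (Eventually.of_forall fun n => (hb n).ge)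
  · exact key 0 (hb.eventually_ge_atTop 0)
  -- Here no positive fraction of detections is guaranteed, and the trivial procedure replaces the
  -- threshold.
  · filter_upwards [(gaussianTail_tendsto_atBot.comp hb).eventually_const_le
      (show 1 - ε < 1 by linarith)] with n hn
    have h1 : supRisk (Θ n) (acceptAll n) ≤ 1 :=
      Real.iSup_le (fun θ => Procedure.risk_acceptAll_le _) zero_le_one
    have h2 := minimaxRisk_le (Θ := Θ n) (acceptAll n)
    simp only [Function.comp_apply] at hn
    linarith

end

lemma tendsto_zero_of_eventually_le {f : ℕ → ℝ} (h1 : ∀ ε > 0, ∀ᶠ n in atTop, -ε ≤ f n)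
    (h2 : ∀ ε > 0, ∀ᶠ n in atTop, f n ≤ ε) : Tendsto f atTop (𝓝 0) := by
  refine Metric.tendsto_nhds.2 fun ε hε => ?_
  filter_upwards [h1 (ε / 2) (half_pos hε), h2 (ε / 2) (half_pos hε)] with n hn1 hn2
  rw [Real.dist_eq, sub_zero, abs_lt]
  constructor <;> linarith

end SparseTesting
end

/-! ### Assembling the four claims -/

theorem mainTheorem6 (s : ℕ → ℕ) (b B : ℕ → ℝ) (Θ : ∀ n, Set (Fin n → ℝ))
    (hs : Tendsto s atTop atTop)
    (hns : Tendsto (fun n : ℕ => (n : ℝ) / (s n : ℝ)) atTop atTop)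
    (hb : (∃ b₀ : ℝ, ∀ n, b n = b₀) ∨ Tendsto b atTop atTop ∨ Tendsto b atTop atBot)
    (hB : ∀ᶠ n : ℕ in atTop, 2 ≤ B n ∧
      B n ≤ Real.exp ((Real.log ((n : ℝ) / (s n : ℝ))) ^ (1 / 4 : ℝ)))
    (hΘ : ∀ n, Θ n = SparseTesting.boundaryClass n (s n) (b n)) :
    -- the infimum of the worst-case FNR over sparsity-preserving sequences is `Φ̄(b) + o(1)`
    (∀ φ ∈ SparseTesting.sparsityPreserving s Θ B, ∀ ε : ℝ, 0 < ε → ∀ᶠ n in atTop,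
      SparseTesting.gaussianTail (b n) - ε ≤ SparseTesting.supFNR (Θ n) (φ n)) ∧
    (∃ φ ∈ SparseTesting.sparsityPreserving s Θ B,
      Tendsto (fun n => SparseTesting.supFNR (Θ n) (φ n) - SparseTesting.gaussianTail (b n))
        atTop (𝓝 0)) ∧
    -- any FDR that is spent everywhere on the class is lost in the combined risk
    (∀ φ ∈ SparseTesting.sparsityPreserving s Θ B, ∀ ε : ℝ, 0 < ε → ∀ᶠ n in atTop,
      SparseTesting.gaussianTail (b n) + SparseTesting.infFDR (Θ n) (φ n) - ε
        ≤ SparseTesting.supRisk (Θ n) (φ n)) ∧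
    -- optimal sparsity-preserving procedures have vanishing FDR
    (∀ φ ∈ SparseTesting.sparsityPreserving s Θ B, SparseTesting.IsAsympMinimax Θ φ →
      Tendsto (fun n => SparseTesting.supFNR (Θ n) (φ n) - SparseTesting.gaussianTail (b n))
        atTop (𝓝 0) ∧
      Tendsto (fun n => SparseTesting.infFDR (Θ n) (φ n)) atTop (𝓝 0) ∧
      ∀ θ : ∀ n, Fin n → ℝ, (∀ᶠ n in atTop, θ n ∈ Θ n) →
        Tendsto (fun n => SparseTesting.Procedure.FNR (θ n) (φ n)
          - SparseTesting.gaussianTail (b n)) atTop (𝓝 0) →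
        Tendsto (fun n => SparseTesting.Procedure.FDR (θ n) (φ n)) atTop (𝓝 0)) := by
  have hB2 : ∀ᶠ n : ℕ in atTop, 2 ≤ B n := hB.mono fun n h => h.1
  have lower : ∀ φ ∈ SparseTesting.sparsityPreserving s Θ B, ∀ ε : ℝ, 0 < ε → ∀ᶠ n in atTop,
      SparseTesting.gaussianTail (b n) - ε ≤ SparseTesting.supFNR (Θ n) (φ n) := fun φ hφ ε hε =>
    SparseTesting.eventually_tail_sub_le_supFNR hs hns hb hB hΘ hφ hε
  have lowerRisk : ∀ φ ∈ SparseTesting.sparsityPreserving s Θ B, ∀ ε : ℝ, 0 < ε → ∀ᶠ n in atTop,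
      SparseTesting.gaussianTail (b n) + SparseTesting.infFDR (Θ n) (φ n) - ε ≤
        SparseTesting.supRisk (Θ n) (φ n) := by
    intro φ hφ ε hε
    filter_upwards [lower φ hφ ε hε, SparseTesting.eventually_nonempty hs hns hΘ] with n h1 h2
    linarith [SparseTesting.infFDR_add_supFNR_le_supRisk (φ n) h2]
  refine ⟨lower, ⟨_, SparseTesting.oracle_mem_sparsityPreserving hs hns hB2 hΘ, ?_⟩, lowerRisk, ?_⟩
  · refine SparseTesting.tendsto_zero_of_eventually_le (fun ε hε => ?_) fun ε hε =>
      Eventually.of_forall fun n => ?_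
    · filter_upwards [lower _ (SparseTesting.oracle_mem_sparsityPreserving hs hns hB2 hΘ) ε hε]
        with n hn
      linarith
    · rw [hΘ]
      linarith [SparseTesting.supFNR_oracle_le n (s n) (b n)]
  · intro φ hφ hmin
    have upper : ∀ ε : ℝ, 0 < ε → ∀ᶠ n in atTop,
        SparseTesting.supRisk (Θ n) (φ n) ≤ SparseTesting.gaussianTail (b n) + ε := by
      intro ε hε
      filter_upwards [SparseTesting.eventually_minimaxRisk_le hs hns hb hΘ (half_pos hε),
        hmin.eventually_le_const (half_pos hε)] with n h1 h2
      linarith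
    refine ⟨SparseTesting.tendsto_zero_of_eventually_le (fun ε hε => ?_) fun ε hε => ?_,
      SparseTesting.tendsto_zero_of_eventually_le (fun ε hε => ?_) fun ε hε => ?_, fun θ hθ hF =>
      SparseTesting.tendsto_zero_of_eventually_le (fun ε hε => ?_) fun ε hε => ?_⟩
    · filter_upwards [lower φ hφ ε hε] with n hn
      linarith
    · filter_upwards [upper ε hε] with n hn
      linarith [SparseTesting.supFNR_le_supRisk (Θ := Θ n) (φ n)]
    · exact Eventually.of_forall fun n => by linarith [SparseTesting.infFDR_nonneg (Θ := Θ n) (φ n)]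
    · filter_upwards [upper _ (half_pos hε), lowerRisk φ hφ _ (half_pos hε)] with n h1 h2
      linarith
    · exact Eventually.of_forall fun n => by linarith [(φ n).FDR_nonneg (θ n)]
    -- At `θ n` the risk is at most `Φ̄(b) + ε / 2` while the FNR is at least `Φ̄(b) - ε / 2`; the
    -- difference bounds the FDR.
    · filter_upwards [upper _ (half_pos hε), hθ,
        hF.eventually_const_le (show -(ε / 2) < 0 by linarith)] with n h1 h2 h3
      have h4 := SparseTesting.risk_le_supRisk (φ n) h2
      unfold SparseTesting.Procedure.risk at h4
      linarith
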